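/- **Formulas and logics.** Formulas are built from a set $At$ of propositional variables by $\alpha ::= p \mid \bot \mid \alpha\to\alpha \mid \Box\alpha$; write $\neg\alpha := \alpha\to\bot$ and $\Diamond\alpha := \neg\Box\neg\alpha$. $\mathcal L$ ranges over the fifteen normal modal logics of the modal cube: classical propositional logic, the axiom $\Box(\alpha\to\beta)\to(\Box\alpha\to\Box\beta)$, modus ponens and necessitation (this is $\mathrm K$), extended with one of the sets of axioms $\varnothing$, $\mathrm B$, $4$, $5$, $45$, $\mathrm B45$, $\mathrm D$, $\mathrm{DB}$, $\mathrm D4$, $\mathrm D5$, $\mathrm D45$, $\mathrm T$, $\mathrm{TB}$, $\mathrm T4$, $\mathrm{TB}45$, where $\mathrm D: \Box\alpha\to\Diamond\alpha$; $\mathrm T: \Box\alpha\to\alpha$; $\mathrm B: \alpha\to\Box\Diamond\alpha$; $4: \Box\alpha\to\Box\Box\alpha$; $5: \Diamond\alpha\to\Box\Diamond\alpha$. An axiom *holds* in $\mathcal L$ if all its instances are theorems of $\mathcal L$. **Truth values.** There are eight values $\mathsf F,\mathsf f,\mathsf{ff},\mathsf{fff},\mathsf{ttt},\mathsf{tt},\mathsf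 t,\mathsf T$. Put $\mathcal D=\{\mathsf T,\mathsf t,\mathsf{tt},\mathsf{ttt}\}$, $\mathcal N=\{\mathsf T,\mathsf{tt},\mathsf{fff},\mathsf{ff}\}$, $\mathcal I=\{\mathsf F,\mathsf{ff},\mathsf{ttt},\mathsf{tt}\}$, $\mathcal P=\{\mathsf T,\mathsf t,\mathsf{fff},\mathsf f\}$, $\mathcal{PN}=\{\mathsf F,\mathsf f,\mathsf{ttt},\mathsf t\}$. The set $\mathcal V(\mathcal L)$ of values of $\mathcal L$ is the set of all eight values for $\mathrm K,\mathrm{KB},\mathrm{K4},\mathrm{K5},\mathrm{K45}$; $\{\mathsf F,\mathsf f,\mathsf{ff},\mathsf{tt},\mathsf t,\mathsf T\}$ for $\mathrm{KB45}$; $\{\mathsf F,\mathsf f,\mathsf{fff},\mathsf{ttt},\mathsf t,\mathsf T\}$ for $\mathrm{KD},\mathrm{KDB},\mathrm{KD4},\mathrm{KD5},\mathrm{KD45}$; and $\{\mathsf F,\mathsf f,\mathsf t,\mathsf T\}$ for $\mathrm{KT},\mathrm{KTB},\mathrm{KT4},\mathrm{KTB45}$. **Nmatrices.** The non-deterministic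 matrix $\mathcal M$ of $\mathcal L$ has values $\mathcal V(\mathcal L)$, designated values $\mathcal V(\mathcal L)\cap\mathcal D$, and the multifunctions $\tilde\bot=\{\mathsf F,\mathsf{ff}\}$, $\tilde\to$ and $\tilde\Box$ below, restricted to $\mathcal V(\mathcal L)$ (each entry lists the elements of a set; for $\tilde\to$ the row is the value of the antecedent; $-$ marks a value that is not in $\mathcal V(\mathcal L)$). \[\begin{array}{c|cccccccc} \tilde\to & \mathsf F & \mathsf f & \mathsf{ff} & \mathsf{fff} & \mathsf{ttt} & \mathsf{tt} & \mathsf t & \mathsf T\\\hline \mathsf F & \mathsf T & \mathsf T & \mathsf T & \mathsf T & \mathsf T & \mathsf T & \mathsf T & \mathsf T\\ \mathsf f & \mathsf t & \mathsf T, \mathsf t & \mathsf{tt} & \mathsf T & \mathsf t & \mathsf T & \mathsf T, \mathsf t & \mathsf T\\ \mathsf{ff} & \mathsf{ttt} & \mathsf t & \mathsf{tt} & \mathsf T & \mathsf{ttt} & \mathsf{tt} & \mathsf t & \mathsf T\\ \mathsf{fff} & \mathsf{ttt} & \mathsf t & \mathsf{tt} & \mathsf T & \mathsf{ttt} & \mathsf{tt}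 & \mathsf t & \mathsf T\\ \mathsf{ttt} & \mathsf{fff} & \mathsf{fff} & \mathsf{fff} & \mathsf{fff} & \mathsf T & \mathsf T & \mathsf T & \mathsf T\\ \mathsf{tt} & \mathsf F & \mathsf f & \mathsf{ff} & \mathsf{fff} & \mathsf{ttt} & \mathsf{tt} & \mathsf{ttt} & \mathsf T\\ \mathsf t & \mathsf f & \mathsf f, \mathsf{fff} & \mathsf{fff} & \mathsf{fff} & \mathsf t & \mathsf T & \mathsf T, \mathsf t & \mathsf T\\ \mathsf T & \mathsf F & \mathsf f & \mathsf{ff} & \mathsf{fff} & \mathsf{ttt} & \mathsf{tt} & \mathsf t & \mathsf T\\ \end{array}\] \[\begin{array}{c|cccccc} \tilde\Box & \mathrm{K} & \mathrm{KB} & \mathrm{K4} & \mathrm{K5} & \mathrm{K45} & \mathrm{KB45}\\\hline \mathsf F & \mathsf F, \mathsf f, \mathsf{fff} & \mathsf F & \mathsf F, \mathsf f, \mathsf{fff} & \mathsf F & \mathsf F & \mathsf F\\ \mathsf f & \mathsf F, \mathsf f, \mathsf{fff} & \mathsf F & \mathsf F, \mathsf f, \mathsf{fff} & \mathsf F & \mathsf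 F & \mathsf F\\ \mathsf{ff} & \mathsf{tt} & \mathsf{tt} & \mathsf{tt} & \mathsf{tt} & \mathsf{tt} & \mathsf{tt}\\ \mathsf{fff} & \mathsf T, \mathsf t, \mathsf{ttt} & \mathsf{ttt} & \mathsf T & \mathsf T, \mathsf{ttt} & \mathsf T & -\\ \mathsf{ttt} & \mathsf F, \mathsf f, \mathsf{fff} & \mathsf F, \mathsf f, \mathsf{fff} & \mathsf F, \mathsf f, \mathsf{fff} & \mathsf F & \mathsf F & -\\ \mathsf{tt} & \mathsf{tt} & \mathsf{tt} & \mathsf{tt} & \mathsf{tt} & \mathsf{tt} & \mathsf{tt}\\ \mathsf t & \mathsf F, \mathsf f, \mathsf{fff} & \mathsf F, \mathsf f, \mathsf{fff} & \mathsf F, \mathsf f, \mathsf{fff} & \mathsf F & \mathsf F & \mathsf F\\ \mathsf T & \mathsf T, \mathsf t, \mathsf{ttt} & \mathsf T, \mathsf t, \mathsf{ttt} & \mathsf T & \mathsf T, \mathsf{ttt} & \mathsf T & \mathsf T\\ \end{array}\] \[\begin{array}{c|ccccc} \tilde\Box & \mathrm{KD} & \mathrm{KDB} & \mathrm{KD4}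 & \mathrm{KD5} & \mathrm{KD45}\\\hline \mathsf F & \mathsf F, \mathsf f, \mathsf{fff} & \mathsf F & \mathsf F & \mathsf F & \mathsf F\\ \mathsf f & \mathsf F, \mathsf f, \mathsf{fff} & \mathsf F & \mathsf F, \mathsf f, \mathsf{fff} & \mathsf F & \mathsf F\\ \mathsf{fff} & \mathsf T, \mathsf t, \mathsf{ttt} & \mathsf{ttt} & \mathsf T & \mathsf T, \mathsf{ttt} & \mathsf T\\ \mathsf{ttt} & \mathsf F, \mathsf f, \mathsf{fff} & \mathsf F, \mathsf f, \mathsf{fff} & \mathsf F & \mathsf F & \mathsf F\\ \mathsf t & \mathsf F, \mathsf f, \mathsf{fff} & \mathsf F, \mathsf f, \mathsf{fff} & \mathsf F, \mathsf f, \mathsf{fff} & \mathsf F & \mathsf F\\ \mathsf T & \mathsf T, \mathsf t, \mathsf{ttt} & \mathsf T, \mathsf t, \mathsf{ttt} & \mathsf T & \mathsf T, \mathsf{ttt} & \mathsf T\\ \end{array}\] \[\begin{array}{c|cccc} \tilde\Box & \mathrm{KT} & \mathrm{KTB} & \mathrm{KT4} & \mathrm{KTB45}\\\hline \mathsf F &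 \mathsf F & \mathsf F & \mathsf F & \mathsf F\\ \mathsf f & \mathsf F, \mathsf f & \mathsf F & \mathsf F, \mathsf f & \mathsf F\\ \mathsf t & \mathsf F, \mathsf f & \mathsf F, \mathsf f & \mathsf F, \mathsf f & \mathsf F\\ \mathsf T & \mathsf T, \mathsf t & \mathsf T, \mathsf t & \mathsf T & \mathsf T\\ \end{array}\] **Valuations and level-valuations.** Let $\Lambda$ be a set of formulas closed under subformulas. A *partial valuation* in $\mathcal M$ with domain $\Lambda$ is a map $v:\Lambda\to\mathcal V(\mathcal L)$ with $v(\bot)\in\tilde\bot$, $v(\alpha\to\beta)\in v(\alpha)\,\tilde\to\, v(\beta)$ and $v(\Box\alpha)\in\tilde\Box(v(\alpha))$ whenever the compound formula (respectively $\bot$) lies in $\Lambda$; it is a *valuation* if $\Lambda$ is the set of all formulas. Let $\mathcal L_0(\mathcal M)$ be the set of valuations $v$ such that, if $v(\alpha)\in\{\mathsf{ff},\mathsf{tt}\}$ for some $\alpha$, then $v(\beta)\in\{\mathsf{ff},\mathsf{tt}\}$ for all $\beta$; let $\mathcal L_{n+1}(\mathcal M)$ be the set of $v\in\mathcal L_n(\mathcal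 M)$ such that $v(\alpha)\in\{\mathsf T,\mathsf{tt}\}$ for every $\alpha$ that satisfies $w(\alpha)\in\mathcal D$ for all $w\in\mathcal L_n(\mathcal M)$. A *level-valuation* in $\mathcal M$ is an element of $\bigcap_{n\ge0}\mathcal L_n(\mathcal M)$. **Models.** An *$\mathcal L$-model* with domain $\Lambda$ is a pair $\langle\Pi,R\rangle$ of a set $\Pi$ of partial valuations in $\mathcal M$ with domain $\Lambda$ and a relation $R\subseteq\Pi\times\Pi$ such that the following hold for all $v\in\Pi$ and $\alpha\in\Lambda$, and for all $w,w',w''\in\Pi$. * Support: if $v(\alpha)\in\mathcal P$, then there is $u\in\Pi$ with $vRu$ and $u(\alpha)\in\mathcal D$; if $v(\alpha)\in\mathcal{PN}$, then there is $u\in\Pi$ with $vRu$ and $u(\alpha)\notin\mathcal D$. * Necessitation: if $wRw'$, then $w(\alpha)\in\mathcal N$ implies $w'(\alpha)\in\mathcal D$, and $w(\alpha)\in\mathcal I$ implies $w'(\alpha)\notin\mathcal D$. * If $\mathrm T$ holds in $\mathcal L$: $w(\alpha)\in\mathcal N$ implies $w(\alpha)\in\mathcal D$, and $w(\alpha)\in\mathcal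 I$ implies $w(\alpha)\notin\mathcal D$. * If $\mathrm D$ holds in $\mathcal L$: $w(\alpha)\in\mathcal N$ implies $w(\alpha)\in\mathcal P$, and $w(\alpha)\in\mathcal I$ implies $w(\alpha)\in\mathcal{PN}$. * If $\mathrm B$ holds in $\mathcal L$ and $wRw'$: $w(\alpha)\in\mathcal D$ implies $w'(\alpha)\in\mathcal P$, and $w(\alpha)\notin\mathcal D$ implies $w'(\alpha)\in\mathcal{PN}$. * If $4$ holds in $\mathcal L$ and $wRw'$: $w(\alpha)\in\mathcal N$ implies $w'(\alpha)\in\mathcal N$, and $w(\alpha)\in\mathcal I$ implies $w'(\alpha)\in\mathcal I$. * If $5$ holds in $\mathcal L$ and $wRw'$: $w(\alpha)\in\mathcal P$ implies $w'(\alpha)\in\mathcal P$, and $w(\alpha)\in\mathcal{PN}$ implies $w'(\alpha)\in\mathcal{PN}$; moreover, if $wRw''$ or $w'Rw''$, then $w(\alpha),w'(\alpha)\in\mathcal N$ implies $w''(\alpha)\in\mathcal N$, and $w(\alpha),w'(\alpha)\in\mathcal I$ implies $w''(\alpha)\in\mathcal I$. A *partial level-valuation* in $\mathcal L$ with domain $\Lambda$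 is a map $v$ on $\Lambda$ such that $v\in\Pi$ for some $\mathcal L$-model $\langle\Pi,R\rangle$ with domain $\Lambda$. **Theorem (Co-analyticity).** Let $\mathcal L$ be any of the fifteen logics of the modal cube and $\mathcal M$ its Nmatrix. For every level-valuation $v$ in $\mathcal M$ and every set $\Lambda$ of formulas closed under subformulas, the restriction $v|_\Lambda$ is a partial level-valuation in $\mathcal L$. -/

import Mathlib

/-! Non-deterministic (level-valuation) semantics for the fifteen logics of the modal cube. -/

universe u

namespace ModalCube

/-- Modal formulas over the set `At` of propositional variables. -/
inductive Formula (At : Type u) : Type u where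
  | atom : At → Formula At
  | bot : Formula At
  | imp : Formula At → Formula At → Formula At
  | box : Formula At → Formula At

namespace Formula

variable {At : Type u}

/-- Negation, `¬α := α → ⊥`. -/
abbrev neg (α : Formula At) : Formula At := imp α bot

/-- Possibility, `◇α := ¬□¬α`. -/
abbrev dia (α : Formula At) : Formula At := neg (box (neg α))

end Formula

open Formula

/-- A set of formulas closed under subformulas. -/
def SubformulaClosed {At : Type u} (Λ : Set (Formula At)) : Prop :=
  (∀ α β : Formula At, imp α β ∈ Λ → α ∈ Λ ∧ β ∈ Λ) ∧
  (∀ α : Formula At, box α ∈ Λ → α ∈ Λ)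

/-! ### The modal axioms and the fifteen logics -/

/-- Names of the modal axiom schemas extending `K`. -/
inductive Ax where
  | d | t | b | four | five
  deriving DecidableEq

/-- The instance of an axiom schema at the formula `α`. -/
def Ax.inst {At : Type u} (X : Ax) (α : Formula At) : Formula At :=
  match X with
  | .d => imp (box α) (dia α)
  | .t => imp (box α) α
  | .b => imp α (box (dia α))
  | .four => imp (box α) (box (box α))
  | .five => imp (dia α) (box (dia α))

/-- The fifteen normal modal logics of the modal cube
(`KT4 = S4`, `KTB45 = S5`, `KB45 = KB5`). -/
inductive Logic where
  | K | KB | K4 | K5 | K45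
  | KB45
  | KD | KDB | KD4 | KD5 | KD45
  | KT | KTB | KT4 | KTB45
  deriving DecidableEq

/-- The axiom schemas that are added to `K` in order to obtain each logic. -/
def Logic.axioms : Logic → Set Ax
  | .K => ∅
  | .KB => {Ax.b}
  | .K4 => {Ax.four}
  | .K5 => {Ax.five}
  | .K45 => {Ax.four, Ax.five}
  | .KB45 => {Ax.b, Ax.four, Ax.five}
  | .KD => {Ax.d}
  | .KDB => {Ax.d, Ax.b}
  | .KD4 => {Ax.d, Ax.four}
  | .KD5 => {Ax.d, Ax.five}
  | .KD45 => {Ax.d, Ax.four, Ax.five}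
  | .KT => {Ax.t}
  | .KTB => {Ax.t, Ax.b}
  | .KT4 => {Ax.t, Ax.four}
  | .KTB45 => {Ax.t, Ax.b, Ax.four, Ax.five}

/-- Theorems of the Hilbert system of a logic: classical propositional axioms, axiom `K`,
the additional modal axioms, modus ponens and necessitation. -/
inductive Provable {At : Type u} (L : Logic) : Formula At → Prop where
  | ax1 (α β : Formula At) : Provable L (imp α (imp β α))
  | ax2 (α β γ : Formula At) :
      Provable L (imp (imp α (imp β γ)) (imp (imp α β) (imp α γ)))
  | ax3 (α : Formula At) : Provable L (imp (neg (neg α)) α)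
  | axK (α β : Formula At) : Provable L (imp (box (imp α β)) (imp (box α) (box β)))
  | modal (X : Ax) (hX : X ∈ L.axioms) (α : Formula At) : Provable L (X.inst α)
  | mp {α β : Formula At} : Provable L (imp α β) → Provable L α → Provable L β
  | nec {α : Formula At} : Provable L α → Provable L (box α)

/-- The axiom schema `X` holds in `L`: all its instances are theorems of `L`. -/
def Logic.Holds (At : Type u) (L : Logic) (X : Ax) : Prop :=
  ∀ α : Formula At, Provable L (X.inst α)

/-! ### Truth values and Nmatrices -/

/-- The eight truth values. -/
inductive TV where
  | vF | vf | vff | vfff | vttt | vtt | vt | vT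
  deriving DecidableEq

open TV

/-- The designated values among all eight: the formula is true. -/
def desig : Finset TV := {vT, vt, vtt, vttt}

/-- The formula is necessary. -/
def setN : Finset TV := {vT, vtt, vfff, vff}

/-- The negation of the formula is necessary. -/
def setI : Finset TV := {vF, vff, vttt, vtt}

/-- The formula is possible. -/
def setP : Finset TV := {vT, vt, vfff, vf}

/-- The negation of the formula is possible. -/
def setPN : Finset TV := {vF, vf, vttt, vt}

/-- A non-deterministic matrix for the signature `⊥, →, □`, with truth values among the eight
values above: its values, its designated values and its multifunctions. -/
structure Nmatrix where
  values : Finset TV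
  designated : Finset TV
  botFn : Finset TV
  impFn : TV → TV → Finset TV
  boxFn : TV → Finset TV

/-- The multifunction of `⊥`. -/
def botTable : Finset TV := {vF, vff}

/-- The multifunction of `→` on all eight values. -/
def impTable : TV → TV → Finset TV
  | vF, vF | vF, vf | vF, vff | vF, vfff | vF, vttt | vF, vtt | vF, vt | vF, vT => {vT}
  | vf, vF | vf, vttt => {vt}
  | vf, vf | vf, vt => {vT, vt}
  | vf, vff => {vtt}
  | vf, vfff | vf, vtt | vf, vT => {vT}
  | vff, vF | vff, vttt => {vttt}
  | vff, vf | vff, vt => {vt}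
  | vff, vff | vff, vtt => {vtt}
  | vff, vfff | vff, vT => {vT}
  | vfff, vF | vfff, vttt => {vttt}
  | vfff, vf | vfff, vt => {vt}
  | vfff, vff | vfff, vtt => {vtt}
  | vfff, vfff | vfff, vT => {vT}
  | vttt, vF | vttt, vf | vttt, vff | vttt, vfff => {vfff}
  | vttt, vttt | vttt, vtt | vttt, vt | vttt, vT => {vT}
  | vtt, vF => {vF}
  | vtt, vf => {vf}
  | vtt, vff => {vff}
  | vtt, vfff => {vfff}
  | vtt, vttt | vtt, vt => {vttt}
  | vtt, vtt => {vtt}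
  | vtt, vT => {vT}
  | vt, vF => {vf}
  | vt, vf => {vf, vfff}
  | vt, vff | vt, vfff => {vfff}
  | vt, vttt => {vt}
  | vt, vtt | vt, vT => {vT}
  | vt, vt => {vT, vt}
  | vT, vF => {vF}
  | vT, vf => {vf}
  | vT, vff => {vff}
  | vT, vfff => {vfff}
  | vT, vttt => {vttt}
  | vT, vtt => {vtt}
  | vT, vt => {vt}
  | vT, vT => {vT}

/-- The multifunction of `□` in each logic; values that are not admissible in the logic
are outside the domain and are sent to `∅`. -/
def boxTable : Logic → TV → Finset TV
  | .K, vF | .K, vf | .K, vttt | .K, vt => {vF, vf, vfff}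
  | .K, vff | .K, vtt => {vtt}
  | .K, vfff | .K, vT => {vT, vt, vttt}
  | .KB, vF | .KB, vf => {vF}
  | .KB, vff | .KB, vtt => {vtt}
  | .KB, vfff => {vttt}
  | .KB, vttt | .KB, vt => {vF, vf, vfff}
  | .KB, vT => {vT, vt, vttt}
  | .K4, vF | .K4, vf | .K4, vttt | .K4, vt => {vF, vf, vfff}
  | .K4, vff | .K4, vtt => {vtt}
  | .K4, vfff | .K4, vT => {vT}
  | .K5, vF | .K5, vf | .K5, vttt | .K5, vt => {vF}
  | .K5, vff | .K5, vtt => {vtt}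
  | .K5, vfff | .K5, vT => {vT, vttt}
  | .K45, vF | .K45, vf | .K45, vttt | .K45, vt => {vF}
  | .K45, vff | .K45, vtt => {vtt}
  | .K45, vfff | .K45, vT => {vT}
  | .KB45, vF | .KB45, vf | .KB45, vt => {vF}
  | .KB45, vff | .KB45, vtt => {vtt}
  | .KB45, vT => {vT}
  | .KD, vF | .KD, vf | .KD, vttt | .KD, vt => {vF, vf, vfff}
  | .KD, vfff | .KD, vT => {vT, vt, vttt}
  | .KDB, vF | .KDB, vf => {vF}
  | .KDB, vfff => {vttt}
  | .KDB, vttt | .KDB, vt => {vF, vf, vfff}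
  | .KDB, vT => {vT, vt, vttt}
  | .KD4, vF | .KD4, vttt => {vF}
  | .KD4, vf | .KD4, vt => {vF, vf, vfff}
  | .KD4, vfff | .KD4, vT => {vT}
  | .KD5, vF | .KD5, vf | .KD5, vttt | .KD5, vt => {vF}
  | .KD5, vfff | .KD5, vT => {vT, vttt}
  | .KD45, vF | .KD45, vf | .KD45, vttt | .KD45, vt => {vF}
  | .KD45, vfff | .KD45, vT => {vT}
  | .KT, vF => {vF}
  | .KT, vf | .KT, vt => {vF, vf}
  | .KT, vT => {vT, vt}
  | .KTB, vF | .KTB, vf => {vF}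
  | .KTB, vt => {vF, vf}
  | .KTB, vT => {vT, vt}
  | .KT4, vF => {vF}
  | .KT4, vf | .KT4, vt => {vF, vf}
  | .KT4, vT => {vT}
  | .KTB45, vF | .KTB45, vf | .KTB45, vt => {vF}
  | .KTB45, vT => {vT}
  | _, _ => ∅

/-- The admissible truth values of each logic. -/
def Logic.values : Logic → Finset TV
  | .K | .KB | .K4 | .K5 | .K45 => {vF, vf, vff, vfff, vttt, vtt, vt, vT}
  | .KB45 => {vF, vf, vff, vtt, vt, vT}
  | .KD | .KDB | .KD4 | .KD5 | .KD45 => {vF, vf, vfff, vttt, vt, vT}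
  | .KT | .KTB | .KT4 | .KTB45 => {vF, vf, vt, vT}

/-- The Nmatrix of a logic: the tables restricted to the admissible values. -/
def Logic.matrix (L : Logic) : Nmatrix where
  values := L.values
  designated := L.values ∩ desig
  botFn := botTable ∩ L.values
  impFn a b := impTable a b ∩ L.values
  boxFn a := boxTable L a

/-! ### Partial valuations and level-valuations -/

section Valuations

variable {At : Type u}

/-- `v` is a partial valuation in `M` with domain `Λ`. -/
def IsPartialValuation (M : Nmatrix) (Λ : Set (Formula At)) (v : Λ → TV) : Prop :=
  (∀ α : Λ, v α ∈ M.values) ∧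
  (∀ h : bot ∈ Λ, v ⟨bot, h⟩ ∈ M.botFn) ∧
  (∀ (α β : Formula At) (hα : α ∈ Λ) (hβ : β ∈ Λ) (h : imp α β ∈ Λ),
    v ⟨imp α β, h⟩ ∈ M.impFn (v ⟨α, hα⟩) (v ⟨β, hβ⟩)) ∧
  (∀ (α : Formula At) (hα : α ∈ Λ) (h : box α ∈ Λ),
    v ⟨box α, h⟩ ∈ M.boxFn (v ⟨α, hα⟩))

/-- `v` is a (total) valuation in `M`. -/
def IsValuation (M : Nmatrix) (v : Formula At → TV) : Prop :=
  (∀ α, v α ∈ M.values) ∧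
  v bot ∈ M.botFn ∧
  (∀ α β, v (imp α β) ∈ M.impFn (v α) (v β)) ∧
  (∀ α, v (box α) ∈ M.boxFn (v α))

/-- The `n`-level-valuations in `M`. -/
def level (M : Nmatrix) : ℕ → Set (Formula At → TV)
  | 0 => {v | IsValuation M v ∧
      ((∃ α, v α ∈ ({vff, vtt} : Set TV)) → ∀ β, v β ∈ ({vff, vtt} : Set TV))}
  | n + 1 => {v | v ∈ level M n ∧
      ∀ α, (∀ w ∈ level M n, w α ∈ M.designated) → v α ∈ ({vT, vtt} : Set TV)}

/-- The level-valuations in `M`. -/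
def levelValuations (M : Nmatrix) : Set (Formula At → TV) :=
  ⋂ n : ℕ, level M n

/-! ### Models on partial valuations -/

/-- `⟨Π, R⟩` is a pre-model over the Nmatrix `M` and the domain `Λ`. -/
structure IsPreModel (M : Nmatrix) (Λ : Set (Formula At))
    (P : Set (Λ → TV)) (R : (Λ → TV) → (Λ → TV) → Prop) : Prop where
  valuation : ∀ v ∈ P, IsPartialValuation M Λ v
  rel_mem : ∀ v w, R v w → v ∈ P ∧ w ∈ P
  supportP : ∀ v ∈ P, ∀ α : Λ, v α ∈ setP → ∃ w ∈ P, R v w ∧ w α ∈ M.designated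
  supportPN : ∀ v ∈ P, ∀ α : Λ, v α ∈ setPN → ∃ w ∈ P, R v w ∧ w α ∉ M.designated

/-- The relational condition of necessitation, imposed in every logic. -/
def NecCondition (M : Nmatrix) (Λ : Set (Formula At))
    (R : (Λ → TV) → (Λ → TV) → Prop) : Prop :=
  ∀ (w w' : Λ → TV) (α : Λ), R w w' →
    (w α ∈ setN → w' α ∈ M.designated) ∧ (w α ∈ setI → w' α ∉ M.designated)

/-- The relational condition that corresponds to a modal axiom. -/
def AxCondition (M : Nmatrix) (Λ : Set (Formula At))
    (P : Set (Λ → TV)) (R : (Λ → TV) → (Λ → TV) → Prop) : Ax → Prop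
  | .t => ∀ w ∈ P, ∀ α : Λ,
      (w α ∈ setN → w α ∈ M.designated) ∧ (w α ∈ setI → w α ∉ M.designated)
  | .d => ∀ w ∈ P, ∀ α : Λ,
      (w α ∈ setN → w α ∈ setP) ∧ (w α ∈ setI → w α ∈ setPN)
  | .b => ∀ (w w' : Λ → TV) (α : Λ), R w w' →
      (w α ∈ M.designated → w' α ∈ setP) ∧ (w α ∉ M.designated → w' α ∈ setPN)
  | .four => ∀ (w w' : Λ → TV) (α : Λ), R w w' →
      (w α ∈ setN → w' α ∈ setN) ∧ (w α ∈ setI → w' α ∈ setI)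
  | .five =>
      (∀ (w w' : Λ → TV) (α : Λ), R w w' →
        (w α ∈ setP → w' α ∈ setP) ∧ (w α ∈ setPN → w' α ∈ setPN)) ∧
      (∀ w ∈ P, ∀ w' ∈ P, ∀ w'' ∈ P, ∀ α : Λ, R w w' → (R w w'' ∨ R w' w'') →
        (w α ∈ setN → w' α ∈ setN → w'' α ∈ setN) ∧
        (w α ∈ setI → w' α ∈ setI → w'' α ∈ setI))

/-- `⟨Π, R⟩` is an `L`-model with domain `Λ`. -/
structure IsModel (L : Logic) (Λ : Set (Formula At))
    (P : Set (Λ → TV)) (R : (Λ → TV) → (Λ → TV) → Prop) : Prop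
    extends IsPreModel L.matrix Λ P R where
  nec : NecCondition L.matrix Λ R
  cond : ∀ X : Ax, L.Holds At X → AxCondition L.matrix Λ P R X

/-- `v : Λ → TV` is a partial level-valuation in `L`: it belongs to some `L`-model. -/
def IsPartialLevelValuation (L : Logic) (Λ : Set (Formula At)) (v : Λ → TV) : Prop :=
  ∃ (P : Set (Λ → TV)) (R : (Λ → TV) → (Λ → TV) → Prop), IsModel L Λ P R ∧ v ∈ P

end Valuations

end ModalCube

namespace ModalCube

open Formula TV

/-! A truth value records three bits about a formula: whether it is true, necessary, impossible.
Under a level-valuation `v` these are the designation of α, □α and □¬α, so `v` is recovered from its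
set of designated formulas (`eq_val_of_level_zero`). Level-valuations designate all theorems
(`exists_level_desig`), hence this set is maximal consistent. Conversely, the frame properties of
the canonical model show that the values read off from any maximal consistent set respect the tables
(`val_imp_mem`, `val_box_mem`).

The model therefore consists of the restrictions to Λ of the valuations of all maximal consistent
sets. Canonical accessibility does not simply descend to it: different sets may have the same
restriction, and the second clause of 5 compares arrows that meet at a point. So each point gets one
representative from which its outgoing arrows are drawn, one with a canonical predecessor if
possible (`exists_representative`): in a Euclidean frame such a set is reflexive. `exists_isModel`
then checks the conditions. -/

instance : Fintype TV :=
  ⟨{vF, vf, vff, vfff, vttt, vtt, vt, vT}, by intro x; cases x <;> decide⟩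

instance : Fintype Logic :=
  ⟨{.K, .KB, .K4, .K5, .K45, .KB45, .KD, .KDB, .KD4, .KD5, .KD45, .KT, .KTB, .KT4, .KTB45},
    by intro x; cases x <;> decide⟩

/-- The finite set of the axiom schemas of a logic. -/
def Logic.axiomFinset : Logic → Finset Ax
  | .K => ∅
  | .KB => {Ax.b}
  | .K4 => {Ax.four}
  | .K5 => {Ax.five}
  | .K45 => {Ax.four, Ax.five}
  | .KB45 => {Ax.b, Ax.four, Ax.five}
  | .KD => {Ax.d}
  | .KDB => {Ax.d, Ax.b}
  | .KD4 => {Ax.d, Ax.four}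
  | .KD5 => {Ax.d, Ax.five}
  | .KD45 => {Ax.d, Ax.four, Ax.five}
  | .KT => {Ax.t}
  | .KTB => {Ax.t, Ax.b}
  | .KT4 => {Ax.t, Ax.four}
  | .KTB45 => {Ax.t, Ax.b, Ax.four, Ax.five}

/-- Makes statements that quantify over all fifteen logics and all values accessible to `decide`. -/
instance (X : Ax) (L : Logic) : Decidable (X ∈ L.axioms) :=
  decidable_of_iff (X ∈ L.axiomFinset) (by cases L <;> simp [Logic.axiomFinset, Logic.axioms])

/-! ### Soundness of the level-valuations -/

section Tables

theorem mem_desig_iff_of_mem_impTable : ∀ x y z : TV, z ∈ impTable x y →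
    (z ∈ desig ↔ (x ∈ desig → y ∈ desig)) := by decide

theorem mem_setN_of_mem_impTable : ∀ x y z : TV, z ∈ impTable x y →
    z ∈ setN → x ∈ setN → y ∈ setN := by decide

/-- The last hypothesis is needed: `vff` and `vtt` describe worlds without successors, and α and ⊥
must agree on whether the world is one. -/
theorem neg_table : ∀ x y z : TV, y ∈ botTable → z ∈ impTable x y →
    (y ∈ ({vff, vtt} : Finset TV) ↔ x ∈ ({vff, vtt} : Finset TV)) →
    ((z ∈ setN ↔ x ∈ setI) ∧ (z ∈ setI ↔ x ∈ setN)) := by decide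

theorem mem_desig_iff_of_mem_boxTable : ∀ (L : Logic) (x z : TV), z ∈ boxTable L x →
    (z ∈ desig ↔ x ∈ setN) := by decide

theorem boxTable_four : ∀ (L : Logic) (x z : TV), Ax.four ∈ L.axioms → z ∈ boxTable L x →
    x ∈ setN → z ∈ setN := by decide

theorem boxTable_five : ∀ (L : Logic) (x z : TV), Ax.five ∈ L.axioms → z ∈ boxTable L x →
    x ∉ setN → z ∈ setI := by decide

theorem boxTable_b : ∀ (L : Logic) (x z : TV), Ax.b ∈ L.axioms → z ∈ boxTable L x →
    x ∉ desig → z ∈ setI := by decide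

theorem values_d : ∀ (L : Logic) (x : TV), Ax.d ∈ L.axioms → x ∈ L.values →
    x ∈ setN → x ∉ setI := by decide

theorem values_t : ∀ (L : Logic) (x : TV), Ax.t ∈ L.axioms → x ∈ L.values →
    x ∈ setN → x ∈ desig := by decide

end Tables

variable {At : Type*} {L : Logic}

theorem level_antitone (M : Nmatrix) : Antitone (level (At := At) M) :=
  antitone_nat_of_succ_le fun _ _ h => h.1

theorem level_subset_zero (M : Nmatrix) (n : ℕ) : level (At := At) M n ⊆ level M 0 :=
  level_antitone M n.zero_le

/-! ### Truth conditions and modal axioms at level zero -/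

section LevelZero

variable {v : Formula At → TV} (hv : v ∈ level L.matrix 0)

include hv

theorem mem_values_of_level_zero (α : Formula At) : v α ∈ L.values := hv.1.1 α

theorem mem_designated_iff_of_level_zero (α : Formula At) :
    v α ∈ L.matrix.designated ↔ v α ∈ desig :=
  Finset.mem_inter.trans (and_iff_right (mem_values_of_level_zero hv α))

theorem box_mem_of_level_zero (α : Formula At) : v (box α) ∈ boxTable L (v α) := hv.1.2.2.2 α

theorem imp_mem_of_level_zero (α β : Formula At) : v (imp α β) ∈ impTable (v α) (v β) :=
  (Finset.mem_inter.1 (hv.1.2.2.1 α β)).1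

theorem bot_mem_of_level_zero : v bot ∈ botTable := (Finset.mem_inter.1 hv.1.2.1).1

theorem imp_desig_iff (α β : Formula At) :
    v (imp α β) ∈ desig ↔ (v α ∈ desig → v β ∈ desig) :=
  mem_desig_iff_of_mem_impTable _ _ _ (imp_mem_of_level_zero hv α β)

theorem bot_not_desig : v bot ∉ desig := by
  have : ∀ x ∈ botTable, x ∉ desig := by decide
  exact this _ (bot_mem_of_level_zero hv)

theorem box_desig_iff (α : Formula At) : v (box α) ∈ desig ↔ v α ∈ setN :=
  mem_desig_iff_of_mem_boxTable L _ _ (box_mem_of_level_zero hv α)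

theorem neg_mem_iff (α : Formula At) :
    (v (neg α) ∈ setN ↔ v α ∈ setI) ∧ (v (neg α) ∈ setI ↔ v α ∈ setN) := by
  refine neg_table _ _ _ (bot_mem_of_level_zero hv) (imp_mem_of_level_zero hv α bot) ?_
  have h : ∀ β, v β ∈ ({vff, vtt} : Finset TV) → ∀ γ, v γ ∈ ({vff, vtt} : Finset TV) := by
    intro β hβ γ
    have := hv.2 ⟨β, by simpa using hβ⟩ γ
    simpa using this
  exact ⟨fun hb => h _ hb _, fun hb => h _ hb _⟩

theorem modal_axiom_desig {X : Ax} (hX : X ∈ L.axioms) (α : Formula At) :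
    v (X.inst α) ∈ desig := by
  have hbot := bot_not_desig hv
  have hval := mem_values_of_level_zero hv
  have hbox := box_mem_of_level_zero hv
  cases X with
  | d =>
    simp only [Ax.inst, imp_desig_iff hv, box_desig_iff hv, neg_mem_iff hv, hbot]
    exact values_d L _ hX (hval α)
  | t =>
    simp only [Ax.inst, imp_desig_iff hv, box_desig_iff hv]
    exact values_t L _ hX (hval α)
  | b =>
    simp only [Ax.inst, imp_desig_iff hv, box_desig_iff hv, neg_mem_iff hv]
    intro h
    refine boxTable_b L _ _ hX (hbox (neg α)) ?_
    simp [imp_desig_iff hv, hbot, h]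
  | four =>
    simp only [Ax.inst, imp_desig_iff hv, box_desig_iff hv]
    exact boxTable_four L _ _ hX (hbox α)
  | five =>
    -- The explicit arguments keep □¬α in the antecedent folded, so that it can be unfolded exactly
    -- once below, to the form that `boxTable_five` expects.
    simp only [Ax.inst, imp_desig_iff hv, box_desig_iff hv (neg (box _)),
      neg_mem_iff hv (box _), hbot]
    intro h
    refine boxTable_five L _ _ hX (hbox (neg α)) ?_
    rwa [box_desig_iff hv] at h

end LevelZero

/-- Axioms are designated at level zero; each necessitation costs one level, and modus ponens takes
the larger of two levels. -/
theorem exists_level_desig {α : Formula At} (h : Provable L α) :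
    ∃ n, ∀ w ∈ level L.matrix n, w α ∈ desig := by
  induction h with
  | ax1 α β =>
    refine ⟨0, fun w hw => ?_⟩
    simp only [imp_desig_iff hw]; tauto
  | ax2 α β γ =>
    refine ⟨0, fun w hw => ?_⟩
    simp only [imp_desig_iff hw]; tauto
  | ax3 α =>
    refine ⟨0, fun w hw => ?_⟩
    simp only [imp_desig_iff hw, bot_not_desig hw]; tauto
  | axK α β =>
    refine ⟨0, fun w hw => ?_⟩
    simp only [imp_desig_iff hw, box_desig_iff hw]
    exact mem_setN_of_mem_impTable _ _ _ (imp_mem_of_level_zero hw α β)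
  | modal X hX α => exact ⟨0, fun w hw => modal_axiom_desig hw hX α⟩
  | mp _ _ ih₁ ih₂ =>
    obtain ⟨m, hm⟩ := ih₁
    obtain ⟨n, hn⟩ := ih₂
    refine ⟨max m n, fun w hw => ?_⟩
    exact (imp_desig_iff (level_subset_zero _ _ hw) _ _).1
      (hm w (level_antitone _ (le_max_left m n) hw))
      (hn w (level_antitone _ (le_max_right m n) hw))
  | @nec α _ ih =>
    obtain ⟨n, hn⟩ := ih
    refine ⟨n + 1, fun w hw => ?_⟩
    have h0 : w ∈ level L.matrix 0 := level_subset_zero _ _ hw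
    have : w α = vT ∨ w α = vtt := hw.2 α fun u hu =>
      (mem_designated_iff_of_level_zero (level_subset_zero _ _ hu) α).2 (hn u hu)
    rw [box_desig_iff h0]
    rcases this with h | h <;> rw [h] <;> decide

/-! ### Maximal consistent sets -/

/-- Maximal consistent sets of formulas of the logic `L`. -/
structure IsMCS (L : Logic) (Γ : Set (Formula At)) : Prop where
  thm : ∀ {α}, Provable L α → α ∈ Γ
  mp : ∀ {α β}, imp α β ∈ Γ → α ∈ Γ → β ∈ Γ
  bot : bot ∉ Γ
  total : ∀ α, α ∈ Γ ∨ neg α ∈ Γ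

/-- Derivability from a set of hypotheses, without necessitation of the hypotheses. -/
inductive Deriv (L : Logic) (Γ : Set (Formula At)) : Formula At → Prop where
  | hyp {α} : α ∈ Γ → Deriv L Γ α
  | thm {α} : Provable L α → Deriv L Γ α
  | mp {α β} : Deriv L Γ (imp α β) → Deriv L Γ α → Deriv L Γ β

theorem Deriv.mono {Γ Δ : Set (Formula At)} (h : Γ ⊆ Δ) {α : Formula At} (hα : Deriv L Γ α) :
    Deriv L Δ α := by
  induction hα with
  | hyp h' => exact .hyp (h h')
  | thm h' => exact .thm h'
  | mp _ _ ih₁ ih₂ => exact .mp ih₁ ih₂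

theorem Deriv.deduction {Γ : Set (Formula At)} {α β : Formula At}
    (h : Deriv L (insert α Γ) β) : Deriv L Γ (imp α β) := by
  induction h with
  | hyp h' =>
    rcases h' with rfl | h'
    -- The combinator proof SKK of α → α; `bot` is an arbitrary filler.
    · exact .mp (.mp (.thm (.ax2 _ (imp _ _) _)) (.thm (.ax1 _ _))) (.thm (.ax1 _ bot))
    · exact .mp (.thm (.ax1 _ _)) (.hyp h')
  | thm h' => exact .mp (.thm (.ax1 _ _)) (.thm h')
  | mp _ _ ih₁ ih₂ => exact .mp (.mp (.thm (.ax2 _ _ _)) ih₁) ih₂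

theorem Deriv.exFalso {Γ : Set (Formula At)} {α : Formula At} (h : Deriv L Γ bot) :
    Deriv L Γ α :=
  .mp (.thm (.ax3 α)) (.mp (.thm (.ax1 _ _)) h)

theorem Deriv.byCases {Γ : Set (Formula At)} {α φ : Formula At}
    (h₁ : Deriv L Γ (imp α φ)) (h₂ : Deriv L Γ (imp (neg α) φ)) : Deriv L Γ φ := by
  refine .mp (.thm (.ax3 φ)) (Deriv.deduction ?_)
  have hs : Γ ⊆ insert (neg φ) Γ := Set.subset_insert _ _
  have hφ : Deriv L (insert (neg φ) Γ) (neg φ) := .hyp (Set.mem_insert _ _)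
  refine .mp hφ (.mp (h₂.mono hs) (Deriv.deduction ?_))
  have hs' : insert (neg φ) Γ ⊆ insert α (insert (neg φ) Γ) := Set.subset_insert _ _
  exact .mp (hφ.mono hs') (.mp (h₁.mono (hs.trans hs')) (.hyp (Set.mem_insert _ _)))

theorem Deriv.exists_mem_of_sUnion {c : Set (Set (Formula At))} (hc : IsChain (· ⊆ ·) c)
    (hne : c.Nonempty) {α : Formula At} (h : Deriv L (⋃₀ c) α) : ∃ Γ ∈ c, Deriv L Γ α := by
  induction h with
  | hyp h' =>
    obtain ⟨Γ, hΓ, h'⟩ := h'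
    exact ⟨Γ, hΓ, .hyp h'⟩
  | thm h' =>
    obtain ⟨Γ, hΓ⟩ := hne
    exact ⟨Γ, hΓ, .thm h'⟩
  | mp _ _ ih₁ ih₂ =>
    obtain ⟨Γ, hΓ, h₁⟩ := ih₁
    obtain ⟨Δ, hΔ, h₂⟩ := ih₂
    rcases hc.total hΓ hΔ with h | h
    · exact ⟨Δ, hΔ, .mp (h₁.mono h) h₂⟩
    · exact ⟨Γ, hΓ, .mp h₁ (h₂.mono h)⟩

/-- Lindenbaum's lemma. -/
theorem exists_isMCS {Γ : Set (Formula At)} {φ : Formula At} (h : ¬ Deriv L Γ φ) :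
    ∃ Δ, Γ ⊆ Δ ∧ IsMCS L Δ ∧ φ ∉ Δ := by
  -- Maximality is taken among sets that do not derive `φ`, so `φ ∉ Δ` is automatic, and every
  -- formula outside `Δ` implies `φ` over `Δ`.
  obtain ⟨Δ, hΓΔ, hΔ⟩ := zorn_subset_nonempty {Θ : Set (Formula At) | ¬ Deriv L Θ φ}
    (fun c hc hch hne => ⟨⋃₀ c, fun hd => by
      obtain ⟨Θ, hΘ, h'⟩ := Deriv.exists_mem_of_sUnion hch hne hd
      exact hc hΘ h', fun s hs => Set.subset_sUnion_of_mem hs⟩) Γ h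
  have hφ : ¬ Deriv L Δ φ := hΔ.prop
  have key : ∀ α, α ∉ Δ → Deriv L Δ (imp α φ) := by
    intro α hα
    refine Deriv.deduction (by_contra fun hd => hα ?_)
    exact hΔ.le_of_ge (y := insert α Δ) hd (Set.subset_insert _ _) (Set.mem_insert _ _)
  have closed : ∀ α, Deriv L Δ α → α ∈ Δ := fun α hα =>
    by_contra fun hn => hφ (.mp (key α hn) hα)
  refine ⟨Δ, hΓΔ, ⟨fun h => closed _ (.thm h), fun h h' => closed _ (.mp (.hyp h) (.hyp h')),
    fun h => hφ (Deriv.exFalso (.hyp h)), fun α => ?_⟩, fun h => hφ (.hyp h)⟩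
  by_contra! hn
  exact hφ (Deriv.byCases (key _ hn.1) (key _ hn.2))

namespace IsMCS

variable {Γ : Set (Formula At)}

theorem imp_mem (hΓ : IsMCS L Γ) {α β : Formula At} : imp α β ∈ Γ ↔ (α ∈ Γ → β ∈ Γ) := by
  refine ⟨hΓ.mp, fun h => ?_⟩
  have closed : ∀ γ, Deriv L Γ γ → γ ∈ Γ := by
    intro γ hγ
    induction hγ with
    | hyp h => exact h
    | thm h => exact hΓ.thm h
    | mp _ _ ih₁ ih₂ => exact hΓ.mp ih₁ ih₂
  refine closed _ (Deriv.deduction ?_)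
  rcases hΓ.total α with hα | hα
  · exact .hyp (Set.mem_insert_of_mem _ (h hα))
  · exact Deriv.exFalso (.mp (.hyp (Set.mem_insert_of_mem _ hα)) (.hyp (Set.mem_insert _ _)))

theorem neg_mem (hΓ : IsMCS L Γ) {α : Formula At} : neg α ∈ Γ ↔ α ∉ Γ := by
  simp [hΓ.imp_mem, hΓ.bot]

end IsMCS

/-- The accessibility relation of the canonical model. -/
def Acc (L : Logic) (Γ Δ : Set (Formula At)) : Prop :=
  IsMCS L Γ ∧ IsMCS L Δ ∧ ∀ α, box α ∈ Γ → α ∈ Δ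

/-- By necessitation and K, whatever follows from the formulas boxed in `Γ` is itself boxed in `Γ`;
otherwise Lindenbaum gives a successor omitting `α`. -/
theorem IsMCS.box_mem {Γ : Set (Formula At)} (hΓ : IsMCS L Γ) {α : Formula At} :
    box α ∈ Γ ↔ ∀ Δ, Acc L Γ Δ → α ∈ Δ := by
  refine ⟨fun h Δ hΔ => hΔ.2.2 α h, fun h => by_contra fun hα => ?_⟩
  have key : ∀ β, Deriv L {γ | box γ ∈ Γ} β → box β ∈ Γ := by
    intro β hβ
    induction hβ with
    | hyp h => exact h
    | thm h => exact hΓ.thm h.nec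
    | mp _ _ ih₁ ih₂ => exact hΓ.mp (hΓ.mp (hΓ.thm (.axK _ _)) ih₁) ih₂
  obtain ⟨Δ, hsub, hΔ, hn⟩ := exists_isMCS fun hd => hα (key α hd)
  exact hn (h Δ ⟨hΓ, hΔ, fun β hβ => hsub hβ⟩)

/-! ### Frame properties of the canonical model -/

section Frame

variable {Γ Δ Θ : Set (Formula At)}

theorem Acc.refl_of_t (hL : L.Holds At .t) (hΓ : IsMCS L Γ) : Acc L Γ Γ :=
  ⟨hΓ, hΓ, fun α => hΓ.imp_mem.1 (hΓ.thm (hL α))⟩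

theorem Acc.serial_of_d (hL : L.Holds At .d) (hΓ : IsMCS L Γ) : ∃ Δ, Acc L Γ Δ := by
  by_contra! hn
  -- At a world without successors □⊥ and □¬⊥ both hold, which refutes D at ⊥.
  have h := hΓ.thm (hL bot)
  simp only [Ax.inst, hΓ.imp_mem, hΓ.bot, hΓ.box_mem] at h
  exact h (fun Δ hΔ => absurd hΔ (hn Δ)) fun Δ hΔ => absurd hΔ (hn Δ)

theorem IsMCS.dia_mem (hΓ : IsMCS L Γ) {α : Formula At} :
    dia α ∈ Γ ↔ ∃ Δ, Acc L Γ Δ ∧ α ∈ Δ := by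
  rw [dia, hΓ.neg_mem, hΓ.box_mem]
  push Not
  refine exists_congr fun Δ => and_congr_right fun h => ?_
  rw [h.2.1.neg_mem, not_not]

theorem Acc.symm_of_b (hL : L.Holds At .b) (h : Acc L Γ Δ) : Acc L Δ Γ := by
  obtain ⟨hΓ, hΔ, h⟩ := h
  refine ⟨hΔ, hΓ, fun α hα => by_contra fun hn => ?_⟩
  have := h _ (hΓ.imp_mem.1 (hΓ.thm (hL (neg α))) (hΓ.neg_mem.2 hn))
  obtain ⟨Θ, hΘ, hα'⟩ := hΔ.dia_mem.1 this
  exact hΘ.2.1.neg_mem.1 hα' (hΘ.2.2 α hα)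

theorem Acc.trans_of_four (hL : L.Holds At .four) (h : Acc L Γ Δ) (h' : Acc L Δ Θ) :
    Acc L Γ Θ :=
  ⟨h.1, h'.2.1, fun α hα => h'.2.2 α (h.2.2 _ (h.1.imp_mem.1 (h.1.thm (hL α)) hα))⟩

theorem Acc.eucl_of_five (hL : L.Holds At .five) (h : Acc L Γ Δ) (h' : Acc L Γ Θ) :
    Acc L Δ Θ := by
  refine ⟨h.2.1, h'.2.1, fun α hα => by_contra fun hn => ?_⟩
  have hd : dia (neg α) ∈ Γ := h.1.dia_mem.2 ⟨Θ, h', h'.2.1.neg_mem.2 hn⟩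
  have := h.2.2 _ (h.1.imp_mem.1 (h.1.thm (hL (neg α))) hd)
  obtain ⟨Ξ, hΞ, hα'⟩ := h.2.1.dia_mem.1 this
  exact hΞ.2.1.neg_mem.1 hα' (hΞ.2.2 α hα)

/-- The table checks need decidable membership among the listed axioms, whereas models impose a
condition for every axiom that holds; the frame lemmas assume the latter and so serve both. -/
theorem Logic.holds_of_mem {X : Ax} (hX : X ∈ L.axioms) : L.Holds At X :=
  fun α => .modal X hX α

end Frame

/-! ### The valuation of a maximal consistent set -/

/-- The truth value of a formula that is true (`a`), necessary (`b`), impossible (`c`). -/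
def enc : Bool → Bool → Bool → TV
  | true, true, false => vT
  | true, false, false => vt
  | true, true, true => vtt
  | true, false, true => vttt
  | false, true, false => vfff
  | false, true, true => vff
  | false, false, false => vf
  | false, false, true => vF

theorem enc_mem_desig : ∀ a b c, enc a b c ∈ desig ↔ a = true := by decide
theorem enc_mem_setN : ∀ a b c, enc a b c ∈ setN ↔ b = true := by decide
theorem enc_mem_setI : ∀ a b c, enc a b c ∈ setI ↔ c = true := by decide
theorem enc_mem_setP : ∀ a b c, enc a b c ∈ setP ↔ ¬ c = true := by decide
theorem enc_mem_setPN : ∀ a b c, enc a b c ∈ setPN ↔ ¬ b = true := by decide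

theorem eq_enc : ∀ (x : TV) (a b c : Bool), (a = true ↔ x ∈ desig) → (b = true ↔ x ∈ setN) →
    (c = true ↔ x ∈ setI) → x = enc a b c := by decide

open Classical in
/-- The valuation that is determined by a set of true formulas. -/
noncomputable def val (Γ : Set (Formula At)) (α : Formula At) : TV :=
  enc (decide (α ∈ Γ)) (decide (box α ∈ Γ)) (decide (box (neg α) ∈ Γ))

section Val

variable {Γ : Set (Formula At)} {α : Formula At}

theorem val_mem_desig : val Γ α ∈ desig ↔ α ∈ Γ := by simp [val, enc_mem_desig]
theorem val_mem_setN : val Γ α ∈ setN ↔ box α ∈ Γ := by simp [val, enc_mem_setN]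
theorem val_mem_setI : val Γ α ∈ setI ↔ box (neg α) ∈ Γ := by simp [val, enc_mem_setI]
theorem val_mem_setP : val Γ α ∈ setP ↔ box (neg α) ∉ Γ := by simp [val, enc_mem_setP]
theorem val_mem_setPN : val Γ α ∈ setPN ↔ box α ∉ Γ := by simp [val, enc_mem_setPN]

end Val

/-- Only closure under theorems uses all levels; the rest is the truth table of → and ⊥ at level
zero. -/
theorem isMCS_of_mem_levelValuations {v : Formula At → TV} (hv : v ∈ levelValuations L.matrix) :
    IsMCS L {α | v α ∈ desig} := by
  have hv' : ∀ n, v ∈ level L.matrix n := Set.mem_iInter.1 hv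
  refine ⟨fun h => ?_, fun {α β} h => (imp_desig_iff (hv' 0) α β).1 h, bot_not_desig (hv' 0),
    fun α => ?_⟩
  · obtain ⟨n, hn⟩ := exists_level_desig h
    exact hn v (hv' n)
  · simp only [Set.mem_ofPred_eq, imp_desig_iff (hv' 0)]
    tauto

theorem eq_val_of_level_zero {v : Formula At → TV} (hv : v ∈ level L.matrix 0) :
    v = val {α | v α ∈ desig} := by
  funext α
  refine eq_enc _ _ _ _ ?_ ?_ ?_ <;>
    simp [box_desig_iff hv, neg_mem_iff hv]

-- The bits `a`, `b`, `c` belong to α, β, α → β. The hypotheses are the Kripke facts about them; the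
-- last two say that α and β agree on whether the world has no successors.
set_option synthInstance.maxHeartbeats 400000 in
set_option synthInstance.maxSize 10000 in
set_option maxRecDepth 10000 in
theorem enc_mem_impTable : ∀ a₁ b₁ a₂ b₂ a₃ b₃ c₁ c₂ c₃ : Bool,
    (c₁ = true ↔ (a₁ = true → b₁ = true)) →
    (a₃ = true → c₂ = true) → (b₂ = true → c₂ = true) →
    (c₂ = true → a₂ = true → b₂ = true) → (c₂ = true → b₃ = true → a₃ = true) →
    (c₃ = true ↔ a₂ = true ∧ b₃ = true) →
    (a₂ = true → a₃ = true → b₂ = true ∧ b₃ = true) →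
    (b₂ = true → b₃ = true → a₂ = true ∧ a₃ = true) →
    enc c₁ c₂ c₃ ∈ impTable (enc a₁ a₂ a₃) (enc b₁ b₂ b₃) := by decide

section Valuation

variable {Γ : Set (Formula At)} (hΓ : IsMCS L Γ)

include hΓ

theorem IsMCS.box_neg_mem {α : Formula At} : box (neg α) ∈ Γ ↔ ∀ Δ, Acc L Γ Δ → α ∉ Δ := by
  rw [hΓ.box_mem]
  exact forall₂_congr fun Δ h => h.2.1.neg_mem

theorem val_bot_mem : val Γ bot ∈ botTable := by
  have h : ∀ b : Bool, enc false b true ∈ botTable := by decide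
  have hb : box (neg bot) ∈ Γ := hΓ.box_neg_mem.2 fun Δ hΔ => hΔ.2.1.bot
  simp [val, hΓ.bot, hb, h]

theorem val_imp_mem (α β : Formula At) :
    val Γ (imp α β) ∈ impTable (val Γ α) (val Γ β) := by
  have hi : box (imp α β) ∈ Γ ↔ ∀ Δ, Acc L Γ Δ → α ∈ Δ → β ∈ Δ := by
    rw [hΓ.box_mem]
    exact forall₂_congr fun Δ h => h.2.1.imp_mem
  have hn : box (neg (imp α β)) ∈ Γ ↔ ∀ Δ, Acc L Γ Δ → α ∈ Δ ∧ β ∉ Δ := by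
    rw [hΓ.box_neg_mem]
    refine forall₂_congr fun Δ h => ?_
    rw [h.2.1.imp_mem]
    tauto
  apply enc_mem_impTable <;>
    simp only [decide_eq_true_eq, hΓ.imp_mem (α := α), hi, hn, hΓ.box_neg_mem (α := α),
      hΓ.box_neg_mem (α := β), hΓ.box_mem (α := α), hΓ.box_mem (α := β)] <;> grind

end Valuation

-- The bits `a` belong to α and `c` to □α. Each guarded hypothesis is what the frame property of the
-- named axioms says about these bits. Under 5 all successors of a world agree on □α, so □□α or □¬□α
-- holds.
set_option synthInstance.maxHeartbeats 400000 in
set_option synthInstance.maxSize 10000 in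
set_option maxRecDepth 10000 in
theorem enc_mem_boxTable : ∀ (L : Logic) (a₁ a₂ a₃ c₁ c₂ c₃ : Bool),
    enc a₁ a₂ a₃ ∈ L.values →
    (c₁ = true ↔ a₂ = true) →
    (a₂ = true → a₃ = true → c₂ = true ∧ c₃ = true) →
    (c₂ = true → c₃ = true → a₂ = true ∧ a₃ = true) →
    (Ax.t ∈ L.axioms → (c₂ = true → c₁ = true) ∧ (c₃ = true → ¬ c₁ = true) ∧
      (a₃ = true → c₃ = true)) →
    (Ax.b ∈ L.axioms → ¬ a₁ = true → c₃ = true) →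
    (Ax.four ∈ L.axioms → a₂ = true → c₂ = true) →
    (Ax.d ∈ L.axioms → Ax.four ∈ L.axioms → a₃ = true → c₃ = true) →
    (Ax.five ∈ L.axioms → (¬ a₂ = true → c₃ = true) ∧ (c₂ = true ∨ c₃ = true)) →
    enc c₁ c₂ c₃ ∈ boxTable L (enc a₁ a₂ a₃) := by
  decide +kernel

-- The excluded values are the bit patterns that reflexivity, seriality, or symmetry with
-- transitivity forbid.
set_option synthInstance.maxHeartbeats 400000 in
set_option synthInstance.maxSize 10000 in
set_option maxRecDepth 10000 in
theorem enc_mem_values : ∀ (L : Logic) (a₁ a₂ a₃ : Bool),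
    (Ax.t ∈ L.axioms → (a₂ = true → a₁ = true) ∧ (a₃ = true → ¬ a₁ = true)) →
    (Ax.d ∈ L.axioms → ¬ (a₂ = true ∧ a₃ = true)) →
    (Ax.b ∈ L.axioms → Ax.four ∈ L.axioms →
      (a₂ = true → ¬ a₃ = true → a₁ = true) ∧ (a₃ = true → ¬ a₂ = true → ¬ a₁ = true)) →
    enc a₁ a₂ a₃ ∈ L.values := by
  decide

section Valuation

variable {Γ : Set (Formula At)} (hΓ : IsMCS L Γ)

include hΓ

theorem val_mem_values (α : Formula At) : val Γ α ∈ L.values := by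
  apply enc_mem_values <;> simp only [decide_eq_true_eq, hΓ.box_neg_mem, hΓ.box_mem]
  · intro h
    have := Acc.refl_of_t (Logic.holds_of_mem h) hΓ
    exact ⟨fun h => h _ this, fun h => h _ this⟩
  · rintro h ⟨h₁, h₂⟩
    obtain ⟨Δ, hΔ⟩ := Acc.serial_of_d (Logic.holds_of_mem h) hΓ
    exact h₂ Δ hΔ (h₁ Δ hΔ)
  · intro hb h4
    -- Under B and 4, a world with a successor is reflexive.
    have key : ∀ Δ, Acc L Γ Δ → Acc L Γ Γ := fun Δ h =>
      h.trans_of_four (Logic.holds_of_mem h4) (h.symm_of_b (Logic.holds_of_mem hb))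
    refine ⟨fun h h' => ?_, fun h h' => ?_⟩
    · push Not at h'
      obtain ⟨Δ, hΔ, -⟩ := h'
      exact h _ (key Δ hΔ)
    · push Not at h'
      obtain ⟨Δ, hΔ, -⟩ := h'
      exact h _ (key Δ hΔ)

theorem val_box_mem (α : Formula At) : val Γ (box α) ∈ boxTable L (val Γ α) := by
  have hbb : box (box α) ∈ Γ ↔ ∀ Δ, Acc L Γ Δ → ∀ Θ, Acc L Δ Θ → α ∈ Θ := by
    rw [hΓ.box_mem]
    exact forall₂_congr fun Δ h => h.2.1.box_mem
  have hbn : box (neg (box α)) ∈ Γ ↔ ∀ Δ, Acc L Γ Δ → ∃ Θ, Acc L Δ Θ ∧ α ∉ Θ := by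
    rw [hΓ.box_neg_mem]
    refine forall₂_congr fun Δ h => ?_
    rw [h.2.1.box_mem]
    push Not
    rfl
  apply enc_mem_boxTable L _ _ _ _ _ _ (val_mem_values hΓ α) <;>
    simp only [decide_eq_true_eq, hbb, hbn, hΓ.box_neg_mem (α := α), hΓ.box_mem (α := α)]
  · grind
  · grind
  · intro h
    have hr : ∀ Δ : Set (Formula At), IsMCS L Δ → Acc L Δ Δ := fun Δ => Acc.refl_of_t (Logic.holds_of_mem h)
    refine ⟨fun h => h Γ (hr Γ hΓ), fun h h' => ?_, fun h Δ hΔ => ⟨Δ, hr Δ hΔ.2.1, h Δ hΔ⟩⟩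
    obtain ⟨Θ, hΘ, hn⟩ := h Γ (hr Γ hΓ)
    exact hn (h' Θ hΘ)
  · exact fun h hα Δ hΔ => ⟨Γ, hΔ.symm_of_b (Logic.holds_of_mem h), hα⟩
  · exact fun h hα Δ hΔ Θ hΘ => hα Θ (hΔ.trans_of_four (Logic.holds_of_mem h) hΘ)
  · intro hd h4 h Δ hΔ
    obtain ⟨Θ, hΘ⟩ := Acc.serial_of_d (Logic.holds_of_mem hd) hΔ.2.1
    exact ⟨Θ, hΘ, h Θ (hΔ.trans_of_four (Logic.holds_of_mem h4) hΘ)⟩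
  · intro h5
    have he : ∀ {Γ Δ Θ}, Acc L Γ Δ → Acc L Γ Θ → Acc L Δ Θ := fun h h' =>
      Acc.eucl_of_five (At := At) (Logic.holds_of_mem h5) h h'
    refine ⟨fun h Δ hΔ => ?_, ?_⟩
    · push Not at h
      obtain ⟨Θ, hΘ, hn⟩ := h
      exact ⟨Θ, he hΔ hΘ, hn⟩
    · by_contra! hn
      obtain ⟨⟨Δ, hΔ, Θ, hΘ, hα⟩, Δ', hΔ', h'⟩ := hn
      -- `Δ` sees `Δ'` and `Θ`, hence `Δ'` sees `Θ`.
      exact hα (h' Θ (he (he hΔ hΔ') hΘ))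

theorem isPartialValuation_val (Λ : Set (Formula At)) :
    IsPartialValuation L.matrix Λ (fun α : Λ => val Γ α) :=
  ⟨fun α => val_mem_values hΓ α,
    fun _ => Finset.mem_inter.2 ⟨val_bot_mem hΓ, val_mem_values hΓ _⟩,
    fun α β _ _ _ => Finset.mem_inter.2 ⟨val_imp_mem hΓ α β, val_mem_values hΓ _⟩,
    fun α _ _ => val_box_mem hΓ α⟩

theorem val_mem_designated {α : Formula At} : val Γ α ∈ L.matrix.designated ↔ α ∈ Γ :=
  (Finset.mem_inter.trans (and_iff_right (val_mem_values hΓ α))).trans val_mem_desig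

end Valuation

/-! ### The model of restrictions -/

/-- The maximal consistent set `Γ` represents the partial valuation `w`. -/
def Represents (L : Logic) (Λ : Set (Formula At)) (Γ : Set (Formula At)) (w : Λ → TV) : Prop :=
  IsMCS L Γ ∧ (fun α : Λ => val Γ α) = w

/-- Represented partial valuations have a representative which has a predecessor in the canonical
model as soon as some representative has one. -/
theorem exists_representative (L : Logic) (Λ : Set (Formula At)) :
    ∃ s : (Λ → TV) → Set (Formula At), ∀ w Γ, Represents L Λ Γ w → Represents L Λ (s w) w ∧
      ∀ Δ, Acc L Δ Γ → ∃ Θ, Acc L Θ (s w) := by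
  have : ∀ w : Λ → TV, ∃ Ξ, ∀ Γ, Represents L Λ Γ w → Represents L Λ Ξ w ∧
      ∀ Δ, Acc L Δ Γ → ∃ Θ, Acc L Θ Ξ := by
    intro w
    -- A representative with a predecessor is preferred; `∅` is a dummy where there is none at all.
    by_cases h : ∃ Γ, Represents L Λ Γ w ∧ ∃ Δ, Acc L Δ Γ
    · obtain ⟨Γ, hΓ, h⟩ := h
      exact ⟨Γ, fun _ _ => ⟨hΓ, fun _ _ => h⟩⟩
    by_cases h' : ∃ Γ, Represents L Λ Γ w
    · obtain ⟨Γ, hΓ⟩ := h'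
      exact ⟨Γ, fun Γ' h' => ⟨hΓ, fun Δ hΔ => absurd ⟨Γ', h', Δ, hΔ⟩ h⟩⟩
    · exact ⟨∅, fun Γ hΓ => absurd ⟨Γ, hΓ⟩ h'⟩
  choose s hs using this
  exact ⟨s, hs⟩

/-- In a Euclidean frame `Θ` sees `Δ`, so every successor of `Θ` is also one of `Δ`. -/
theorem box_mem_of_acc_of_five (hL : L.Holds At .five) {Γ Δ Θ : Set (Formula At)}
    (h : Acc L Γ Δ) (h' : Acc L Γ Θ) {α : Formula At} (hα : box α ∈ Δ) : box α ∈ Θ :=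
  h'.2.1.box_mem.2 fun _ hΞ => h.2.1.box_mem.1 hα _ (Acc.eucl_of_five hL (h'.eucl_of_five hL h) hΞ)

theorem exists_isModel (L : Logic) (Λ : Set (Formula At)) :
    ∃ R, IsModel L Λ {w | ∃ Γ, Represents L Λ Γ w} R := by
  obtain ⟨s, hs⟩ := exists_representative L Λ
  -- The source is fixed to be `s w`, so that two arrows out of `w` start at the same maximal
  -- consistent set; the target may be any representative.
  let R : (Λ → TV) → (Λ → TV) → Prop := fun w w' =>
    Represents L Λ (s w) w ∧ ∃ Δ, Represents L Λ Δ w' ∧ Acc L (s w) Δ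
  have hsucc : ∀ {Γ w}, Represents L Λ Γ w → ∀ {Δ : Set (Formula At)}, Acc L (s w) Δ →
      R w (fun α : Λ => val Δ α) := fun {Γ w} h {Δ} hΔ =>
    ⟨(hs w Γ h).1, Δ, ⟨hΔ.2.1, rfl⟩, hΔ⟩
  have hmem : ∀ {Γ w}, Represents L Λ Γ w → ∀ α : Λ, w α = val Γ α := by
    rintro Γ w ⟨-, rfl⟩ α
    rfl
  -- Relational conditions on single pairs reduce to the canonical model.
  have hpair : ∀ {w w'}, R w w' → ∃ Γ Δ : Set (Formula At), Acc L Γ Δ ∧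
      ∀ α : Λ, w α = val Γ α ∧ w' α = val Δ α := by
    rintro w w' ⟨h, Δ, hΔ, ha⟩
    exact ⟨_, Δ, ha, fun α => ⟨hmem h α, hmem hΔ α⟩⟩
  refine ⟨R, ⟨⟨?_, ?_, ?_, ?_⟩, ?_, ?_⟩⟩
  · rintro _ ⟨Γ, hΓ, rfl⟩
    exact isPartialValuation_val hΓ Λ
  · rintro v w ⟨h, Δ, hΔ, -⟩
    exact ⟨⟨_, h⟩, Δ, hΔ⟩
  · rintro v ⟨Γ, h⟩ α hα
    have hr := (hs v Γ h).1
    rw [hmem hr, val_mem_setP, hr.1.box_neg_mem] at hα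
    push Not at hα
    obtain ⟨Δ, hΔ, hα⟩ := hα
    exact ⟨_, ⟨Δ, hΔ.2.1, rfl⟩, hsucc h hΔ, (val_mem_designated hΔ.2.1).2 hα⟩
  · rintro v ⟨Γ, h⟩ α hα
    have hr := (hs v Γ h).1
    rw [hmem hr, val_mem_setPN, hr.1.box_mem] at hα
    push Not at hα
    obtain ⟨Δ, hΔ, hα⟩ := hα
    exact ⟨_, ⟨Δ, hΔ.2.1, rfl⟩, hsucc h hΔ, fun hd => hα ((val_mem_designated hΔ.2.1).1 hd)⟩
  · intro w w' α hR
    obtain ⟨Γ, Δ, ha, h⟩ := hpair hR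
    rw [(h α).1, (h α).2, val_mem_setN, val_mem_setI, val_mem_designated ha.2.1]
    exact ⟨fun hb => ha.1.box_mem.1 hb Δ ha, fun hb => ha.1.box_neg_mem.1 hb Δ ha⟩
  · intro X hX
    cases X with
    | t =>
      rintro w ⟨Γ, h⟩ α
      have ha := Acc.refl_of_t hX h.1
      rw [hmem h, val_mem_setN, val_mem_setI, val_mem_designated h.1]
      exact ⟨fun hb => h.1.box_mem.1 hb Γ ha, fun hb => h.1.box_neg_mem.1 hb Γ ha⟩
    | d =>
      rintro w ⟨Γ, h⟩ α
      obtain ⟨Δ, ha⟩ := Acc.serial_of_d hX h.1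
      rw [hmem h, val_mem_setN, val_mem_setI, val_mem_setP, val_mem_setPN, h.1.box_mem,
        h.1.box_neg_mem]
      exact ⟨fun h h' => h' Δ ha (h Δ ha), fun h h' => h Δ ha (h' Δ ha)⟩
    | b =>
      intro w w' α hR
      obtain ⟨Γ, Δ, ha, h⟩ := hpair hR
      have ha' := ha.symm_of_b hX
      rw [(h α).1, (h α).2, val_mem_designated ha.1, val_mem_setP, val_mem_setPN,
        ha.2.1.box_neg_mem, ha.2.1.box_mem]
      exact ⟨fun h h' => h' Γ ha' h, fun h h' => h (h' Γ ha')⟩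
    | four =>
      intro w w' α hR
      obtain ⟨Γ, Δ, ha, h⟩ := hpair hR
      rw [(h α).1, (h α).2, val_mem_setN, val_mem_setI, val_mem_setN, val_mem_setI]
      -- Used at `α` for necessity and at `neg α` for impossibility.
      have key : ∀ β : Formula At, box β ∈ Γ → box β ∈ Δ := fun β hβ =>
        ha.2.2 _ (ha.1.imp_mem.1 (ha.1.thm (hX β)) hβ)
      exact ⟨key _, key _⟩
    | five =>
      refine ⟨fun w w' α hR => ?_, ?_⟩
      · obtain ⟨Γ, Δ, ha, h⟩ := hpair hR
        rw [(h α).1, (h α).2, val_mem_setP, val_mem_setPN, val_mem_setP, val_mem_setPN]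
        have key : ∀ β : Formula At, box β ∉ Γ → box β ∉ Δ := by
          intro β hβ hβ'
          refine hβ (ha.1.box_mem.2 fun Θ hΘ => ?_)
          exact (ha.eucl_of_five hX hΘ).2.2 β hβ'
        exact ⟨key _, key _⟩
      · rintro w - w' - w'' - α ⟨hw, Δ, hΔ, ha⟩ hR
        have key : ∃ Δ', Represents L Λ Δ' w' ∧ ∃ Θ, Represents L Λ Θ w'' ∧
            ∀ β : Formula At, box β ∈ Δ' → box β ∈ Θ := by
          rcases hR with ⟨-, Θ, hΘ, ha'⟩ | ⟨hw', Θ, hΘ, ha'⟩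
          · exact ⟨Δ, hΔ, Θ, hΘ, fun β => box_mem_of_acc_of_five hX ha ha'⟩
          -- The arrow into `w'` ends at `Δ`, the arrow out of it starts at `s w'`. Since `Δ` has a
          -- predecessor, so does `s w'`, which is then reflexive; thus `s w'` and `Θ` are both
          -- successors of `s w'`.
          · obtain ⟨Ξ, hΞ⟩ := (hs w' Δ hΔ).2 _ ha
            exact ⟨_, hw', Θ, hΘ, fun β =>
              box_mem_of_acc_of_five hX (hΞ.eucl_of_five hX hΞ) ha'⟩
        obtain ⟨Δ', hΔ', Θ, hΘ, h⟩ := key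
        rw [hmem hΔ', hmem hΘ, val_mem_setN, val_mem_setI, val_mem_setN, val_mem_setI]
        exact ⟨fun _ => h _, fun _ => h _⟩

end ModalCube

theorem mainTheorem4 {At : Type*} (L : ModalCube.Logic)
    (v : ModalCube.Formula At → ModalCube.TV)
    (hv : v ∈ ModalCube.levelValuations L.matrix)
    (Λ : Set (ModalCube.Formula At)) (hΛ : ModalCube.SubformulaClosed Λ) :
    ModalCube.IsPartialLevelValuation L Λ (fun α : Λ => v α) := by
  obtain ⟨R, hR⟩ := ModalCube.exists_isModel L Λ
  refine ⟨_, R, hR, _, ModalCube.isMCS_of_mem_levelValuations hv, ?_⟩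
  rw [← ModalCube.eq_val_of_level_zero (Set.mem_iInter.1 hv 0)]
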